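/- For a set $X\subset\mathbb C^n$ and $x,y\in X$ let $d_X(x,y)\in[0,\infty]$ be the infimum of the lengths of the continuous paths in $X$ joining $x$ to $y$ ($d_X(x,y)=\infty$ if there is no such path of finite length). The set $X$ is called normally embedded if there is a constant $C>0$ with $d_X(x,y)\le C\|x-y\|$ for all $x,y\in X$, where $\|\cdot\|$ is the Euclidean norm; it is called normally embedded at a point $p\in X$ if $U\cap X$ is normally embedded for some neighborhood $U$ of $p$. Corollary 4.3 (Brieskorn). Let $n\ge 2$, let $a_1,\dots,a_n$ be nonzero complex numbers, and let $k_1,\dots,k_n$ be integers with $1<k_1<k_2$ and $k_2\le\cdots\le k_n$. Then the Pham–Brieskorn hypersurface $$X=\{x\in\mathbb C^n \mid a_1x_1^{k_1}+\cdots+a_nx_n^{k_n}=0\}$$ is not normally embedded at the origin. -/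

import Mathlib

open scoped ENNReal NNReal Topology

/-- The inner distance of a subset `X` of a metric space: the infimum of the lengths of the
continuous paths from `x` to `y` that stay in `X`. It is `∞` if there is no such path of finite
length. -/
noncomputable def innerEDist {E : Type*} [PseudoEMetricSpace E] (X : Set E) (x y : E) : ℝ≥0∞ :=
  ⨅ (γ : Path x y) (_ : ∀ t, γ t ∈ X), eVariationOn γ Set.univ

/-- `X` is (Lipschitz) normally embedded: the inner distance is at most a finite constant times
the outer distance. -/
def IsNormallyEmbedded {E : Type*} [PseudoEMetricSpace E] (X : Set E) : Prop :=
  ∃ C : ℝ≥0, 0 < C ∧ ∀ x ∈ X, ∀ y ∈ X, innerEDist X x y ≤ C * edist x y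

/-- `X` is normally embedded at the point `p`: some neighborhood `U` of `p` is such that `U ∩ X`
is normally embedded. -/
def IsNormallyEmbeddedAt {E : Type*} [PseudoEMetricSpace E] (X : Set E) (p : E) : Prop :=
  ∃ U ∈ 𝓝 p, IsNormallyEmbedded (U ∩ X)

/-- The Pham-Brieskorn hypersurface `∑ aᵢ xᵢ ^ kᵢ = 0` in `ℂⁿ` with its Euclidean metric. -/
def phamBrieskorn {n : ℕ} (a : Fin n → ℂ) (k : Fin n → ℕ) : Set (EuclideanSpace ℂ (Fin n)) :=
  {x | ∑ i, a i * x i ^ k i = 0}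

/-! For every root `c` of `c ^ k i₀ = -(a i₁ / a i₀)` the hypersurface contains the curve `s ↦ (c s
^ k i₁, s ^ k i₀, 0, …, 0)`. Two such curves, for `c` and `w * c` with `w ≠ 1` a root of unity, are
only `O(s ^ k i₁)` apart, which is `o(s ^ k i₀)`. Normal embedding would join them by a path staying
within `ε s ^ k i₀` of its source. There the equation keeps `(x i₀ / (c s ^ k i₁)) ^ k i₀` in the
unit disc about `1` (`norm_div_pow_sub_one_le`), so `x i₀ / (c s ^ k i₁)` cannot change branch of
the root and go from `1` to `w` (`eq_one_of_pow_mem_slitPlane`). -/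

/-- A continuous function whose `m`-th power stays in the slit plane and which starts at `1` and
ends at an `m`-th root of unity ends at `1`. -/
theorem eq_one_of_pow_mem_slitPlane {m : ℕ} (hm : m ≠ 0) {h : unitInterval → ℂ}
    (hc : Continuous h) (hs : ∀ t, h t ^ m ∈ Complex.slitPlane) (h0 : h 0 = 1)
    (h1 : h 1 ^ m = 1) : h 1 = 1 := by
  have hm' : (m : ℂ) ≠ 0 := Nat.cast_ne_zero.mpr hm
  -- `u` is the principal `m`-th root of `h ^ m`; `h / u` is continuous with values in the finite
  -- set of roots of unity, hence constant.
  let u : unitInterval → ℂ := fun t => Complex.exp (Complex.log (h t ^ m) / m)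
  have hu : Continuous u :=
    Complex.continuous_exp.comp (((hc.pow m).clog hs).div_const _)
  have hum : ∀ t, u t ^ m = h t ^ m := fun t => by
    simp only [u]
    rw [← Complex.exp_nat_mul, mul_div_cancel₀ _ hm',
      Complex.exp_log (Complex.slitPlane_ne_zero (hs t))]
  have hq : Continuous fun t => h t / u t := hc.div hu fun t => Complex.exp_ne_zero _
  have hroots : ∀ t, h t / u t ∈ ((Polynomial.nthRootsFinset m (1 : ℂ) : Finset ℂ) : Set ℂ) := by
    intro t
    rw [Finset.mem_coe, Polynomial.mem_nthRootsFinset (Nat.pos_of_ne_zero hm), div_pow, hum,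
      div_self (Complex.slitPlane_ne_zero (hs t))]
  have hsub := (Finset.countable_toSet (Polynomial.nthRootsFinset m (1 : ℂ))).isTotallyDisconnected
    (Set.range fun t => h t / u t) (Set.range_subset_iff.mpr hroots) (isPreconnected_range hq)
  have := hsub ⟨1, rfl⟩ ⟨0, rfl⟩
  simpa [u, h0, h1] using this

/-- On a Pham-Brieskorn hypersurface, close to a point `(c s ^ k₂, s ^ k₁, 0, …, 0)`, the power
`x₁ ^ k₁` is close to its value at that point, relative to the size of that value. -/
theorem norm_div_pow_sub_one_le {ι : Type*} [Fintype ι] [DecidableEq ι] {a : ι → ℂ} {k : ι → ℕ}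
    {i₀ i₁ : ι} (hne : i₁ ≠ i₀) (ha₁ : a i₁ ≠ 0)
    (hk : ∀ i, i ≠ i₀ → k i₁ ≤ k i) {c : ℂ} (hc : c ^ k i₀ = -(a i₁ / a i₀))
    {s : ℝ} (hs : 0 < s) (hs1 : s ≤ 1) {y : ι → ℂ} (hy : ∑ i, a i * y i ^ k i = 0) :
    ‖(y i₀ / (c * s ^ k i₁)) ^ k i₀ - 1‖ ≤
      ∑ i ∈ Finset.univ.erase i₀,
        ‖a i / a i₁‖ * ‖(y i / s ^ k i₀) ^ k i - Pi.single (M := fun _ => ℂ) i₁ 1 i‖ := by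
  have hs' : (s : ℂ) ≠ 0 := Complex.ofReal_ne_zero.mpr hs.ne'
  -- The equation divided by `a i₁ * s ^ (k i₀ * k i₁)`. Since `k i₁ ≤ k i`, the remaining powers of
  -- `s` are nonnegative, so they are at most `1` in norm.
  have key : (y i₀ / (c * s ^ k i₁)) ^ k i₀ - 1 = ∑ i ∈ Finset.univ.erase i₀,
      a i / a i₁ * (s : ℂ) ^ (k i₀ * (k i - k i₁)) *
        ((y i / s ^ k i₀) ^ k i - Pi.single (M := fun _ => ℂ) i₁ 1 i) := by
    have hterm : ∀ i ∈ Finset.univ.erase i₀, a i / a i₁ * (s : ℂ) ^ (k i₀ * (k i - k i₁)) *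
        ((y i / s ^ k i₀) ^ k i - Pi.single (M := fun _ => ℂ) i₁ 1 i) =
        a i * y i ^ k i / (a i₁ * s ^ (k i₀ * k i₁)) - Pi.single (M := fun _ => ℂ) i₁ 1 i := by
      intro i hi
      have hki := hk i (Finset.ne_of_mem_erase hi)
      have h1 : a i / a i₁ * (s : ℂ) ^ (k i₀ * (k i - k i₁)) * (y i / s ^ k i₀) ^ k i =
          a i * y i ^ k i / (a i₁ * s ^ (k i₀ * k i₁)) := by
        have h2 : (s : ℂ) ^ (k i₀ * k i) = s ^ (k i₀ * (k i - k i₁)) * s ^ (k i₀ * k i₁) := by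
          rw [← pow_add, ← mul_add, Nat.sub_add_cancel hki]
        rw [div_pow, ← pow_mul, h2]
        field_simp
      rw [mul_sub, h1]
      by_cases hi1 : i = i₁
      · subst hi1; simp [ha₁]
      · simp [Pi.single_eq_of_ne hi1]
    rw [Finset.sum_congr rfl hterm, Finset.sum_sub_distrib, ← Finset.sum_div]
    have hsum : ∑ i ∈ Finset.univ.erase i₀, a i * y i ^ k i = -(a i₀ * y i₀ ^ k i₀) := by
      rw [← Finset.add_sum_erase _ _ (Finset.mem_univ i₀)] at hy
      linear_combination hy
    have hsing : ∑ i ∈ Finset.univ.erase i₀, Pi.single (M := fun _ => ℂ) i₁ 1 i = 1 := by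
      rw [Finset.sum_pi_single']
      simp [hne]
    rw [hsum, hsing, div_pow, mul_pow, hc, ← pow_mul, mul_comm (k i₁)]
    field_simp
  rw [key]
  refine (norm_sum_le _ _).trans (Finset.sum_le_sum fun i _ => ?_)
  rw [norm_mul, norm_mul]
  refine mul_le_mul_of_nonneg_right (mul_le_of_le_one_right (norm_nonneg _) ?_) (norm_nonneg _)
  rw [norm_pow, Complex.norm_real, Real.norm_of_nonneg hs.le]
  exact pow_le_one₀ hs.le hs1

/-- Points at inner distance less than `r` are joined by a path that stays within `r` of its
source. -/
theorem exists_path_of_innerEDist_lt {E : Type*} [PseudoEMetricSpace E] {X : Set E} {x y : E}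
    {r : ℝ≥0∞} (h : innerEDist X x y < r) :
    ∃ γ : Path x y, (∀ t, γ t ∈ X) ∧ ∀ t, edist (γ t) x < r := by
  simp only [innerEDist, iInf_lt_iff] at h
  obtain ⟨γ, hγ, hlt⟩ := h
  refine ⟨γ, hγ, fun t => lt_of_le_of_lt ?_ hlt⟩
  simpa using eVariationOn.edist_le γ (Set.mem_univ t) (Set.mem_univ 0)

/-- The point `(c s ^ k₂, s ^ k₁, 0, …, 0)`. -/
noncomputable def sheetPoint {ι : Type*} [DecidableEq ι] (i₀ i₁ : ι) (k : ι → ℕ) (c : ℂ) (s : ℝ) :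
    EuclideanSpace ℂ ι :=
  EuclideanSpace.single i₀ (c * s ^ k i₁) + EuclideanSpace.single i₁ ((s : ℂ) ^ k i₀)

section sheetPoint

variable {ι : Type*} [DecidableEq ι] {i₀ i₁ : ι} {k : ι → ℕ}

theorem sheetPoint_apply (hne : i₁ ≠ i₀) (c : ℂ) (s : ℝ) :
    sheetPoint i₀ i₁ k c s i₀ = c * s ^ k i₁ := by
  simp [sheetPoint, hne.symm]

theorem sheetPoint_apply_of_ne {i : ι} (hi : i ≠ i₀) (c : ℂ) (s : ℝ) :
    sheetPoint i₀ i₁ k c s i = s ^ k i₀ * Pi.single (M := fun _ => ℂ) i₁ 1 i := by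
  by_cases h : i = i₁
  · subst h; simp [sheetPoint, hi]
  · simp [sheetPoint, hi, h]

theorem continuous_sheetPoint [Fintype ι] (c : ℂ) : Continuous (sheetPoint i₀ i₁ k c) := by
  refine (PiLp.continuous_toLp 2 _).comp (f := fun s i => sheetPoint i₀ i₁ k c s i) ?_
  refine continuous_pi fun i => ?_
  simp only [sheetPoint, PiLp.add_apply, PiLp.single_apply]
  split_ifs <;> fun_prop

theorem sheetPoint_zero (h₀ : k i₀ ≠ 0) (h₁ : k i₁ ≠ 0) (c : ℂ) : sheetPoint i₀ i₁ k c 0 = 0 := by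
  ext i
  simp [sheetPoint, h₀, h₁]

theorem dist_sheetPoint [Fintype ι] (c d : ℂ) {s : ℝ} (hs : 0 ≤ s) :
    dist (sheetPoint i₀ i₁ k c s) (sheetPoint i₀ i₁ k d s) = ‖c - d‖ * s ^ k i₁ := by
  rw [sheetPoint, sheetPoint, dist_add_right, PiLp.dist_single_same, dist_eq_norm,
    ← sub_mul, norm_mul, norm_pow, Complex.norm_real, Real.norm_of_nonneg hs]

end sheetPoint

theorem sheetPoint_mem_phamBrieskorn {n : ℕ} {a : Fin n → ℂ} {k : Fin n → ℕ} {i₀ i₁ : Fin n}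
    (hne : i₁ ≠ i₀) (ha₀ : a i₀ ≠ 0) (hk : ∀ i, k i ≠ 0) {c : ℂ}
    (hc : c ^ k i₀ = -(a i₁ / a i₀)) (s : ℝ) :
    sheetPoint i₀ i₁ k c s ∈ phamBrieskorn a k := by
  simp only [phamBrieskorn, Set.mem_ofPred_eq]
  rw [← Finset.add_sum_erase _ _ (Finset.mem_univ i₀),
    Finset.sum_eq_single_of_mem i₁ (by simp [hne]), sheetPoint_apply hne,
    sheetPoint_apply_of_ne hne, mul_pow, hc, Pi.single_eq_same, mul_one, ← pow_mul, ← pow_mul,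
    mul_comm (k i₁)]
  · field_simp
    ring
  · intro i hi hi1
    rw [sheetPoint_apply_of_ne (Finset.ne_of_mem_erase hi), Pi.single_eq_of_ne hi1]
    simp [hk i]

/-- The continuous bound of `norm_div_pow_sub_one_le` is below `1` near the point `e₁`. -/
theorem exists_sum_norm_pow_sub_single_lt_one {ι : Type*} [Fintype ι] [DecidableEq ι] (b : ι → ℝ)
    {k : ι → ℕ} (hk : ∀ i, k i ≠ 0) (i₁ : ι) (S : Finset ι) :
    ∃ ε > 0, ∀ z : ι → ℂ, (∀ i ∈ S, ‖z i - Pi.single (M := fun _ => ℂ) i₁ 1 i‖ < ε) →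
      ∑ i ∈ S, b i * ‖z i ^ k i - Pi.single (M := fun _ => ℂ) i₁ 1 i‖ < 1 := by
  let e : ι → ℂ := Pi.single i₁ 1
  let F : (ι → ℂ) → ℝ := fun z => ∑ i ∈ S, b i * ‖z i ^ k i - e i‖
  have hF : Continuous F := by fun_prop
  have he : F e = 0 := by
    refine Finset.sum_eq_zero fun i _ => ?_
    by_cases h : i = i₁
    · subst h; simp [e]
    · simp [e, Pi.single_eq_of_ne h, hk i]
  obtain ⟨ε, hε, hball⟩ := Metric.isOpen_iff.mp (isOpen_lt hF continuous_const) e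
    (show F e < 1 by rw [he]; exact one_pos)
  refine ⟨ε, hε, fun z hz => ?_⟩
  -- Only the coordinates in `S` are controlled; the others are reset to those of `e`, which leaves
  -- the sum unchanged.
  have hmem : (fun i => if i ∈ S then z i else e i) ∈ Metric.ball e ε := by
    rw [Metric.mem_ball, dist_pi_lt_iff hε]
    intro i
    by_cases hi : i ∈ S
    · simpa [hi, dist_eq_norm] using hz i hi
    · simpa [hi] using hε
  refine lt_of_eq_of_lt (Finset.sum_congr rfl fun i hi => ?_) (hball hmem)
  simp [hi, e]

/-- A Pham-Brieskorn hypersurface whose smallest exponent is at least `2` and is attained only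
once is not normally embedded at the origin. -/
theorem not_isNormallyEmbeddedAt_phamBrieskorn {n : ℕ} {a : Fin n → ℂ} {k : Fin n → ℕ}
    {i₀ i₁ : Fin n} (hne : i₁ ≠ i₀) (ha₀ : a i₀ ≠ 0) (ha₁ : a i₁ ≠ 0) (hk₁ : 1 < k i₀)
    (hk₂ : k i₀ < k i₁) (hk : ∀ i, i ≠ i₀ → k i₁ ≤ k i) :
    ¬ IsNormallyEmbeddedAt (phamBrieskorn a k) 0 := by
  rintro ⟨U, hU, C, -, hUC⟩
  have hk0 : ∀ i, k i ≠ 0 := fun i => by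
    by_cases h : i = i₀
    · subst h; omega
    · have := hk i h; omega
  obtain ⟨c, hc⟩ := IsAlgClosed.exists_pow_nat_eq (-(a i₁ / a i₀)) (Nat.pos_of_ne_zero (hk0 i₀))
  have hc0 : c ≠ 0 := by
    rintro rfl
    rw [zero_pow (hk0 i₀)] at hc
    exact neg_ne_zero.mpr (div_ne_zero ha₁ ha₀) hc.symm
  obtain ⟨w, hw⟩ : ∃ w : ℂ, IsPrimitiveRoot w (k i₀) := ⟨_, Complex.isPrimitiveRoot_exp _ (hk0 i₀)⟩
  have hwc : (w * c) ^ k i₀ = -(a i₁ / a i₀) := by rw [mul_pow, hw.pow_eq_one, one_mul, hc]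
  obtain ⟨ε, hε, hbound⟩ := exists_sum_norm_pow_sub_single_lt_one
    (fun i => ‖a i / a i₁‖) hk0 i₁ (Finset.univ.erase i₀)
  have hnear : ∀ d : ℂ, ∀ᶠ s in 𝓝[>] (0 : ℝ), sheetPoint i₀ i₁ k d s ∈ U := fun d => by
    refine ((continuous_sheetPoint (k := k) d).tendsto 0).mono_left nhdsWithin_le_nhds ?_
    rwa [sheetPoint_zero (hk0 i₀) (hk0 i₁)]
  -- This is `C * ‖c - w * c‖ * s ^ k i₁ < ε * s ^ k i₀` with `s ^ k i₀` cancelled; `k i₀ < k i₁`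
  -- makes the left side tend to `0`.
  have hsmall : ∀ᶠ s in 𝓝[>] (0 : ℝ), C * ‖c - w * c‖ * s ^ (k i₁ - k i₀) < ε := by
    refine nhdsWithin_le_nhds (ContinuousAt.eventually_lt (by fun_prop) continuousAt_const ?_)
    simpa [(Nat.sub_pos_of_lt hk₂).ne'] using hε
  obtain ⟨s, hp, hq, hsε, hs0, hs1⟩ := ((hnear c).and <| (hnear (w * c)).and <| hsmall.and <|
    Ioc_mem_nhdsGT one_pos).exists
  have hs' : (s : ℂ) ≠ 0 := Complex.ofReal_ne_zero.mpr hs0.ne'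
  have hlt : innerEDist (U ∩ phamBrieskorn a k) (sheetPoint i₀ i₁ k c s)
      (sheetPoint i₀ i₁ k (w * c) s) < ENNReal.ofReal (ε * s ^ k i₀) := by
    refine (hUC _ ⟨hp, sheetPoint_mem_phamBrieskorn hne ha₀ hk0 hc s⟩ _
      ⟨hq, sheetPoint_mem_phamBrieskorn hne ha₀ hk0 hwc s⟩).trans_lt ?_
    rw [edist_dist, dist_sheetPoint c _ hs0.le, ← ENNReal.ofReal_coe_nnreal,
      ← ENNReal.ofReal_mul C.coe_nonneg, ENNReal.ofReal_lt_ofReal_iff (by positivity),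
      ← Nat.sub_add_cancel hk₂.le, pow_add, ← mul_assoc, ← mul_assoc]
    exact mul_lt_mul_of_pos_right hsε (by positivity)
  obtain ⟨γ, hγX, hγ⟩ := exists_path_of_innerEDist_lt hlt
  let h : unitInterval → ℂ := fun t => γ t i₀ / (c * s ^ k i₁)
  have hcont : Continuous h := by
    have : Continuous fun t => γ t i₀ :=
      (EuclideanSpace.proj (𝕜 := ℂ) i₀).continuous.comp γ.continuous
    exact this.div_const _
  have hslit : ∀ t, h t ^ k i₀ ∈ Complex.slitPlane := by
    intro t
    apply Complex.ball_one_subset_slitPlane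
    rw [mem_ball_iff_norm]
    -- After division by `s ^ k i₀`, closeness to the source becomes `ε`-closeness to `e₁` in the
    -- coordinates other than `i₀`.
    refine (norm_div_pow_sub_one_le hne ha₁ hk hc hs0 hs1 (hγX t).2).trans_lt
      (hbound (fun i => γ t i / s ^ k i₀) fun i hi => ?_)
    have hd : ‖γ t i - sheetPoint i₀ i₁ k c s i‖ < ε * s ^ k i₀ := by
      have h1 := hγ t
      rw [edist_dist, ENNReal.ofReal_lt_ofReal_iff (by positivity), dist_eq_norm] at h1
      exact (PiLp.norm_apply_le (γ t - sheetPoint i₀ i₁ k c s) i).trans_lt h1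
    rw [sheetPoint_apply_of_ne (Finset.ne_of_mem_erase hi)] at hd
    have hdiv : γ t i / s ^ k i₀ - Pi.single (M := fun _ => ℂ) i₁ 1 i =
        (γ t i - s ^ k i₀ * Pi.single (M := fun _ => ℂ) i₁ 1 i) / s ^ k i₀ := by
      field_simp
    rw [hdiv, norm_div, norm_pow, Complex.norm_real, Real.norm_of_nonneg hs0.le,
      div_lt_iff₀ (by positivity)]
    exact hd
  have h0 : h 0 = 1 := by
    simp only [h, γ.source, sheetPoint_apply hne]
    exact div_self (mul_ne_zero hc0 (pow_ne_zero _ hs'))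
  have h1 : h 1 = w := by
    simp only [h, γ.target, sheetPoint_apply hne]
    field_simp
  refine hw.ne_one hk₁ ?_
  rw [← h1]
  exact eq_one_of_pow_mem_slitPlane (hk0 i₀) hcont hslit h0 (by rw [h1, hw.pow_eq_one])

theorem corollary4p3 (n : ℕ) (hn : 2 ≤ n) (a : Fin n → ℂ) (ha : ∀ i, a i ≠ 0)
    (k : Fin n → ℕ)
    (hk₁ : 1 < k ⟨0, by omega⟩)
    (hk₂ : k ⟨0, by omega⟩ < k ⟨1, by omega⟩)
    (hk : ∀ i j : Fin n, 1 ≤ (i : ℕ) → i ≤ j → k i ≤ k j) :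
    ¬ IsNormallyEmbeddedAt (phamBrieskorn a k) 0 := by
  refine not_isNormallyEmbeddedAt_phamBrieskorn (i₀ := ⟨0, by omega⟩) (i₁ := ⟨1, by omega⟩)
    (by simp) (ha _) (ha _) hk₁ hk₂ fun i hi => hk _ i le_rfl ?_
  rw [Fin.le_def]
  exact Nat.one_le_iff_ne_zero.mpr fun h => hi (Fin.ext h)
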